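/- Let $\mathbf{FHilb}$ be the category of finite-dimensional complex Hilbert spaces and linear maps. Let $\mathbf{Quant}$ be the symmetric monoidal category whose objects are the finite-dimensional complex Hilbert spaces and whose morphisms $A\to B$ are the completely positive (not necessarily trace-preserving) linear maps $B(A)\to B(B)$ between the operator algebras, with the usual tensor product and unit $\mathbb{C}$. Let $F\colon\mathbf{FHilb}\to\mathbf{Quant}$ be the functor that is the identity on objects and sends a linear map $f$ to the completely positive map $\rho\mapsto f\rho f^\dagger$. For each nonzero finite-dimensional Hilbert space $A$ let the completely mixed state $\mathrm{mix}_A\colon\mathbb{C}\to A$ in $\mathbf{Quant}$ be the map $z\mapsto z\cdot\mathrm{id}_A$, and let $\mathcal{M}'$ be the collection of all of these. Call a morphism $g\colon X\to Y$ of $\mathbf{Quant}$ pure if for every $f\in\mathcal{M}'$ and all objects $A,B$, the morphism $f\otimes\mathrm{id}_A$ has the left lifting property against $g\otimes\mathrm{id}_B$, i.e. whenever $(g\otimes\mathrm{id}_B)\circ a=b\circ(f\otimes\mathrm{id}_A)$ there is a morphism $h$ with $h\circ(f\otimes\mathrm{id}_A)=a$ and $(g\otimes\mathrm{id}_B)\circ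 h=b$. Then a morphism $p\colon A\to B$ of $\mathbf{Quant}$ is pure if and only if $p=F(f)$ for some linear map $f\colon A\to B$. -/

import Mathlib

open CategoryTheory MonoidalCategory
open scoped TensorProduct InnerProduct CStarAlgebra

set_option linter.unusedSectionVars false

noncomputable section

/-! ### Lifting properties in symmetric monoidal categories -/

section Lifting

universe v u

variable {C : Type u} [Category.{v} C] [MonoidalCategory C] [SymmetricCategory C]

/-- `f ⊘ g`: for all objects `A` and `B`, the morphism `f ⊗ 𝟙 A` has the left lifting property
against `g ⊗ 𝟙 B`. -/
def MonoidalLift {X Y Z W : C} (f : X ⟶ Y) (g : Z ⟶ W) : Prop :=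
  ∀ A B : C, HasLiftingProperty (f ▷ A) (g ▷ B)

/-- The class of all morphisms `g` such that `f ⊘ g` for every `f` in the class `𝒜`. -/
def monoidalRlp (𝒜 : MorphismProperty C) : MorphismProperty C :=
  fun _ _ g => ∀ ⦃X Y : C⦄ (f : X ⟶ Y), 𝒜 f → MonoidalLift f g

/-- The pure morphisms with respect to a class `ℳ'` of completely mixed states. -/
def pureMorphisms (ℳ' : MorphismProperty C) : MorphismProperty C :=
  monoidalRlp ℳ'

end Lifting

/-! ### Finite-dimensional Hilbert spaces -/

/-- Finite-dimensional complex Hilbert spaces (the zero space is allowed). -/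
structure FHilb : Type 1 where
  carrier : Type
  [normedAddCommGroup : NormedAddCommGroup carrier]
  [innerProductSpace : InnerProductSpace ℂ carrier]
  [finiteDimensional : FiniteDimensional ℂ carrier]

namespace FHilb

instance : CoeSort FHilb Type := ⟨carrier⟩

attribute [instance] normedAddCommGroup innerProductSpace finiteDimensional

instance (A : FHilb) : CompleteSpace A := FiniteDimensional.complete ℂ A

/-- Morphisms are the linear maps (automatically continuous). -/
instance : Category FHilb where
  Hom A B := A →L[ℂ] B
  id A := ContinuousLinearMap.id ℂ A
  comp f g := g ∘L f

/-- The Hilbert space tensor product. -/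
abbrev tensor (A B : FHilb) : FHilb := ⟨A ⊗[ℂ] B⟩

/-- The one-dimensional Hilbert space `ℂ`. -/
abbrev one : FHilb := ⟨ℂ⟩

/-- The algebra of operators on a finite-dimensional Hilbert space. -/
abbrev Op (A : FHilb) : Type := A →L[ℂ] A

end FHilb

open FHilb

/-! ### Auxiliary facts on positive matrices of operators -/

namespace QuantAux

section CStar

variable {A : Type*} [CStarAlgebra A] [PartialOrder A] [StarOrderedRing A]

lemma exists_of_nonneg {n : Type} [Fintype n] {M : CStarMatrix n n A} (hM : 0 ≤ M) :
    ∃ (m : ℕ) (S : Fin m → n → A), ∀ i j, M i j = ∑ k, star (S k i) * S k j := by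
  rw [StarOrderedRing.nonneg_iff] at hM
  induction hM using AddSubmonoid.closure_induction with
  | mem x hx =>
    obtain ⟨T, rfl⟩ := hx
    refine ⟨Fintype.card n, fun k => T ((Fintype.equivFin n).symm k), fun i j => ?_⟩
    dsimp only
    rw [CStarMatrix.mul_apply,
      ← Equiv.sum_comp (Fintype.equivFin n).symm]
    rfl
  | zero => exact ⟨0, fun k => k.elim0, fun i j => by simp⟩
  | add x y _ _ hx hy =>
    obtain ⟨m, S, hS⟩ := hx
    obtain ⟨m', S', hS'⟩ := hy
    refine ⟨m + m', Fin.append S S', fun i j => ?_⟩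
    rw [CStarMatrix.add_apply, hS, hS', Fin.sum_univ_add]
    simp

lemma nonneg_of_sum {n κ : Type} [Fintype n] [Fintype κ] (M : CStarMatrix n n A)
    (S : κ → n → A) (h : ∀ i j, M i j = ∑ k, star (S k i) * S k j) : 0 ≤ M := by
  classical
  rcases isEmpty_or_nonempty n with hn | ⟨⟨i₀⟩⟩
  · exact le_of_eq (CStarMatrix.ext fun i => hn.elim i)
  · let T : κ → CStarMatrix n n A := fun k =>
      CStarMatrix.ofMatrix (Matrix.of fun i j => if i = i₀ then S k j else 0)
    have key : M = ∑ k, star (T k) * T k := by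
      have hent : ∀ k i j, (star (T k) * T k) i j = star (S k i) * S k j := by
        intro k i j
        have hT : ∀ a b, T k a b = if a = i₀ then S k b else 0 := fun _ _ => rfl
        rw [CStarMatrix.mul_apply, Finset.sum_eq_single i₀]
        · simp [CStarMatrix.star_apply, hT]
        · intro b _ hb
          simp [hT, hb]
        · simp
      have hsum : ∀ (s : Finset κ) i j, (∑ k ∈ s, star (T k) * T k : CStarMatrix n n A) i j
          = ∑ k ∈ s, (star (T k) * T k) i j := by
        intro s i j
        induction s using Finset.induction_on with
        | empty => simp
        | insert a s ha ih =>
          rw [Finset.sum_insert ha, Finset.sum_insert ha, CStarMatrix.add_apply, ih]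
      refine CStarMatrix.ext fun i j => ?_
      rw [hsum, h]
      exact Finset.sum_congr rfl fun k _ => (hent k i j).symm
    rw [key]
    exact Finset.sum_nonneg fun k _ => star_mul_self_nonneg _

end CStar

/-- Matrices of the form `∑ₖ (Rₖᵢ)† Rₖⱼ` are positive, also for maps `Rₖᵢ` into another space. -/
lemma nonneg_of_sum_adjoint {A B : FHilb} {n κ : Type} [Fintype n] [Fintype κ]
    (M : CStarMatrix n n (Op B)) (R : κ → n → (B →L[ℂ] A))
    (h : ∀ i j, M i j = ∑ k, ContinuousLinearMap.adjoint (R k i) ∘L R k j) : 0 ≤ M := by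
  classical
  rcases subsingleton_or_nontrivial B with hB | hB
  · exact le_of_eq (CStarMatrix.ext fun i j => by
      ext x; exact Subsingleton.elim _ _)
  · obtain ⟨u, hu⟩ := exists_norm_eq B (zero_le_one' ℝ)
    let e := stdOrthonormalBasis ℂ A
    refine nonneg_of_sum (κ := κ × Fin (Module.finrank ℂ A)) M
      (fun k i => InnerProductSpace.rankOne ℂ u (ContinuousLinearMap.adjoint (R k.1 i) (e k.2)))
      fun i j => ?_
    rw [h, Fintype.sum_prod_type]
    refine Finset.sum_congr rfl fun k _ => ?_
    refine ContinuousLinearMap.ext fun x => ?_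
    have hx := e.sum_repr' (R k j x)
    conv_lhs => rw [ContinuousLinearMap.comp_apply, ← hx]
    simp [ContinuousLinearMap.star_eq_adjoint, InnerProductSpace.rankOne_apply, map_sum,
      ContinuousLinearMap.adjoint_inner_left, hu,
      inner_self_eq_norm_sq_to_K]

lemma exists_of_completelyPositive {X Y : Type*} [CStarAlgebra X] [PartialOrder X]
    [StarOrderedRing X] [CStarAlgebra Y] [PartialOrder Y] [StarOrderedRing Y]
    {ι : Type} [Fintype ι] (φ : X →CP Y) (x : ι → X) :
    ∃ (p : ℕ) (c : Fin p → ι → Y), ∀ i j, φ (star (x i) * x j) = ∑ r, star (c r i) * c r j :=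
  exists_of_nonneg (φ.map_cstarMatrix_nonneg
    (CStarMatrix.ofMatrix (Matrix.of fun i j => star (x i) * x j))
    (nonneg_of_sum _ (fun (_ : Unit) i => x i) fun i j => by simp))

section OpTensor

variable {H K H' K' : Type}
  [NormedAddCommGroup H] [InnerProductSpace ℂ H] [FiniteDimensional ℂ H]
  [NormedAddCommGroup K] [InnerProductSpace ℂ K] [FiniteDimensional ℂ K]
  [NormedAddCommGroup H'] [InnerProductSpace ℂ H'] [FiniteDimensional ℂ H']
  [NormedAddCommGroup K'] [InnerProductSpace ℂ K'] [FiniteDimensional ℂ K']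

variable (H K) in
/-- The canonical isomorphism `B(H) ⊗ B(K) ≃ B(H ⊗ K)` for finite-dimensional spaces. -/
def opTensorEquiv : (H →L[ℂ] H) ⊗[ℂ] (K →L[ℂ] K) ≃ₗ[ℂ] (H ⊗[ℂ] K →L[ℂ] H ⊗[ℂ] K) :=
  (TensorProduct.congr LinearMap.toContinuousLinearMap.symm
    LinearMap.toContinuousLinearMap.symm) ≪≫ₗ (homTensorHomEquiv ℂ H K H K) ≪≫ₗ
    LinearMap.toContinuousLinearMap

lemma opTensorEquiv_tmul (a : H →L[ℂ] H) (b : K →L[ℂ] K) :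
    opTensorEquiv H K (a ⊗ₜ b) = TensorProduct.mapL a b := by
  refine ContinuousLinearMap.ext fun x => ?_
  rw [TensorProduct.mapL_apply]
  change homTensorHomEquiv ℂ H K H K ((a : H →ₗ[ℂ] H) ⊗ₜ[ℂ] (b : K →ₗ[ℂ] K)) x = _
  rw [homTensorHomEquiv_apply]
  rfl

lemma opTensor_ext {V : Type*} [AddCommGroup V] [Module ℂ V]
    {f g : (H ⊗[ℂ] K →L[ℂ] H ⊗[ℂ] K) →ₗ[ℂ] V}
    (h : ∀ a b, f (TensorProduct.mapL a b) = g (TensorProduct.mapL a b)) : f = g := by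
  have : f ∘ₗ (opTensorEquiv H K).toLinearMap = g ∘ₗ (opTensorEquiv H K).toLinearMap := by
    refine TensorProduct.ext' fun a b => ?_
    simpa [opTensorEquiv_tmul] using h a b
  refine LinearMap.ext fun x => ?_
  obtain ⟨y, rfl⟩ := (opTensorEquiv H K).surjective x
  exact LinearMap.congr_fun this y

/-- The tensor product `φ ⊗ ψ : B(H ⊗ K) → B(H' ⊗ K')` of linear maps `φ : B(H) → B(H')` and
`ψ : B(K) → B(K')`. -/
def opTensorMap (φ : (H →L[ℂ] H) →ₗ[ℂ] (H' →L[ℂ] H')) (ψ : (K →L[ℂ] K) →ₗ[ℂ] (K' →L[ℂ] K')) :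
    (H ⊗[ℂ] K →L[ℂ] H ⊗[ℂ] K) →ₗ[ℂ] (H' ⊗[ℂ] K' →L[ℂ] H' ⊗[ℂ] K') :=
  (opTensorEquiv H' K').toLinearMap ∘ₗ TensorProduct.map φ ψ ∘ₗ (opTensorEquiv H K).symm.toLinearMap

lemma opTensorMap_mapL (φ : (H →L[ℂ] H) →ₗ[ℂ] (H' →L[ℂ] H'))
    (ψ : (K →L[ℂ] K) →ₗ[ℂ] (K' →L[ℂ] K')) (a : H →L[ℂ] H) (b : K →L[ℂ] K) :
    opTensorMap φ ψ (TensorProduct.mapL a b) = TensorProduct.mapL (φ a) (ψ b) := by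
  simp [opTensorMap, ← opTensorEquiv_tmul]

/-- The tensor product of operators, as a bilinear map. -/
def mapLBilin : (H →L[ℂ] H) →ₗ[ℂ] (K →L[ℂ] K) →ₗ[ℂ] (H ⊗[ℂ] K →L[ℂ] H ⊗[ℂ] K) :=
  LinearMap.mk₂ ℂ TensorProduct.mapL TensorProduct.mapL_add_left TensorProduct.mapL_smul_left
    TensorProduct.mapL_add_right TensorProduct.mapL_smul_right

lemma exists_sum_mapL {ι : Type} [Fintype ι] (e : Module.Basis ι ℂ (K →L[ℂ] K))
    (x : H ⊗[ℂ] K →L[ℂ] H ⊗[ℂ] K) :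
    ∃ c : ι → (H →L[ℂ] H), x = ∑ l, TensorProduct.mapL (c l) (e l) := by
  obtain ⟨y, rfl⟩ := (opTensorEquiv H K).surjective x
  induction y using TensorProduct.induction_on with
  | zero => exact ⟨0, by rw [LinearEquiv.map_zero]; simp⟩
  | tmul a b =>
    refine ⟨fun l => e.repr b l • a, ?_⟩
    have hb := congrArg (mapLBilin a) (e.sum_repr b)
    rw [map_sum] at hb
    rw [opTensorEquiv_tmul]
    refine hb.symm.trans (Finset.sum_congr rfl fun l _ => ?_)
    simp [mapLBilin, TensorProduct.mapL_smul_left]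
  | add y z hy hz =>
    obtain ⟨c, hc⟩ := hy
    obtain ⟨d, hd⟩ := hz
    refine ⟨c + d, ?_⟩
    rw [LinearEquiv.map_add, hc, hd, ← Finset.sum_add_distrib]
    simp [TensorProduct.mapL_add_left]

lemma mapL_sum_sum {ι κ : Type} [Fintype ι] [Fintype κ]
    (a : ι → (H →L[ℂ] H)) (b : κ → (K →L[ℂ] K)) :
    TensorProduct.mapL (∑ i, a i) (∑ j, b j) = ∑ i, ∑ j, TensorProduct.mapL (a i) (b j) := by
  change mapLBilin (∑ i, a i) (∑ j, b j) = ∑ i, ∑ j, mapLBilin (a i) (b j)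
  rw [LinearMap.map_sum₂]
  simp only [map_sum]

lemma star_mapL [CompleteSpace H] [CompleteSpace K] [CompleteSpace (H ⊗[ℂ] K)]
    (a : H →L[ℂ] H) (b : K →L[ℂ] K) :
    star (TensorProduct.mapL a b) = TensorProduct.mapL (star a) (star b) :=
  TensorProduct.adjoint_mapL a b

lemma sum_comm₄ {α β γ δ R : Type*} [Fintype α] [Fintype β] [Fintype γ] [Fintype δ]
    [AddCommMonoid R] (f : α → β → γ → δ → R) :
    ∑ a, ∑ b, ∑ c, ∑ d, f a b c d = ∑ c, ∑ d, ∑ a, ∑ b, f a b c d := by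
  have h : ∀ a, ∑ b, ∑ c, ∑ d, f a b c d = ∑ c, ∑ d, ∑ b, f a b c d := fun a => by
    rw [Finset.sum_comm]
    exact Finset.sum_congr rfl fun c _ => Finset.sum_comm
  rw [Finset.sum_congr rfl fun a _ => h a, Finset.sum_comm]
  exact Finset.sum_congr rfl fun c _ => Finset.sum_comm

/-- The tensor product of completely positive maps is completely positive. -/
lemma opTensorMap_nonneg [CompleteSpace H] [CompleteSpace K] [CompleteSpace (H ⊗[ℂ] K)]
    [CompleteSpace H'] [CompleteSpace K'] [CompleteSpace (H' ⊗[ℂ] K')]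
    (φ : (H →L[ℂ] H) →CP (H' →L[ℂ] H')) (ψ : (K →L[ℂ] K) →CP (K' →L[ℂ] K'))
    (n : ℕ) (M : CStarMatrix (Fin n) (Fin n) (H ⊗[ℂ] K →L[ℂ] H ⊗[ℂ] K)) (hM : 0 ≤ M) :
    0 ≤ M.map (opTensorMap φ.toLinearMap ψ.toLinearMap) := by
  obtain ⟨m, S, hS⟩ := exists_of_nonneg hM
  let e := Module.finBasis ℂ (K →L[ℂ] K)
  choose a ha using fun k i => exists_sum_mapL (H := H) e (S k i)
  obtain ⟨p, c, hc⟩ := exists_of_completelyPositive φ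
    (fun x : Fin m × Fin n × Fin (Module.finrank ℂ (K →L[ℂ] K)) => a x.1 x.2.1 x.2.2)
  obtain ⟨q, d, hd⟩ := exists_of_completelyPositive ψ e
  have hc' : ∀ x y, φ.toLinearMap (star (a x.1 x.2.1 x.2.2) * a y.1 y.2.1 y.2.2) =
    ∑ r, star (c r x) * c r y := hc
  have hd' : ∀ x y, ψ.toLinearMap (star (e x) * e y) = ∑ r, star (d r x) * d r y := hd
  refine nonneg_of_sum (κ := Fin m × Fin p × Fin q) _
    (fun k i => ∑ l, TensorProduct.mapL (c k.2.1 (k.1, i, l)) (d k.2.2 l)) fun i j => ?_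
  have h1 : M i j = ∑ k, ∑ l, ∑ l', TensorProduct.mapL
      (star (a k i l) * a k j l') (star (e l) * e l') := by
    rw [hS]
    refine Finset.sum_congr rfl fun k _ => ?_
    rw [ha, ha, star_sum, Finset.sum_mul_sum]
    simp only [star_mapL, TensorProduct.mapL_mul]
  rw [CStarMatrix.map_apply, h1, Fintype.sum_prod_type]
  simp only [map_sum, opTensorMap_mapL]
  refine Finset.sum_congr rfl fun k _ => ?_
  have h2 : ∀ l l', TensorProduct.mapL (φ.toLinearMap (star (a k i l) * a k j l'))
      (ψ.toLinearMap (star (e l) * e l')) = ∑ r, ∑ s,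
      star (TensorProduct.mapL (c r (k, i, l)) (d s l)) *
        TensorProduct.mapL (c r (k, j, l')) (d s l') := by
    intro l l'
    rw [hd', hc' (k, i, l) (k, j, l'), mapL_sum_sum]
    simp only [star_mapL, TensorProduct.mapL_mul]
  simp only [h2, star_sum, Finset.sum_mul_sum, Fintype.sum_prod_type]
  rw [sum_comm₄]

end OpTensor

end QuantAux

open QuantAux

/-! ### The category of completely positive maps -/

/-- The objects of the category of finite-dimensional Hilbert spaces and completely positive maps:
a type synonym of `FHilb`, carrying different morphisms. -/
structure Quant : Type 1 where
  space : FHilb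

namespace Quant

/-- The identity as a completely positive map. -/
def cpId (A : FHilb) : Op A →CP Op A where
  toLinearMap := LinearMap.id
  map_cstarMatrix_nonneg' _ _ hM := hM

/-- Composition of completely positive maps. -/
def cpComp {A B C : FHilb} (φ : Op A →CP Op B) (ψ : Op B →CP Op C) : Op A →CP Op C where
  toLinearMap := ψ.toLinearMap ∘ₗ φ.toLinearMap
  map_cstarMatrix_nonneg' k M hM :=
    ψ.map_cstarMatrix_nonneg' k _ (φ.map_cstarMatrix_nonneg' k M hM)

/-- Tensor product of completely positive maps; it sends `a ⊗ b` to `φ a ⊗ ψ b`. -/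
def cpTensor {A B A' B' : FHilb} (φ : Op A →CP Op A') (ψ : Op B →CP Op B') :
    Op (tensor A B) →CP Op (tensor A' B') where
  toLinearMap := opTensorMap φ.toLinearMap ψ.toLinearMap
  map_cstarMatrix_nonneg' := opTensorMap_nonneg φ ψ

/-- The completely positive map `ρ ↦ f ρ f†` of conjugation by a linear map `f`. -/
def cpConj {A B : FHilb} (f : A →L[ℂ] B) : Op A →CP Op B where
  toFun ρ := f ∘L ρ ∘L ContinuousLinearMap.adjoint f
  map_add' ρ σ := by simp
  map_smul' c ρ := by simp
  map_cstarMatrix_nonneg' k M hM := by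
    obtain ⟨m, S, hS⟩ := exists_of_nonneg hM
    refine nonneg_of_sum_adjoint (A := A) _
      (fun r i => S r i ∘L ContinuousLinearMap.adjoint f) fun i j => ?_
    refine ContinuousLinearMap.ext fun x => ?_
    simp [CStarMatrix.map_apply, hS, ContinuousLinearMap.adjoint_comp,
      ContinuousLinearMap.star_eq_adjoint]

/-- The completely positive map `B(ℂ) → B(A)` that sends (the operator of multiplication by) a
scalar `z` to `z` times the identity of `A`. -/
def cpMix (A : FHilb) : Op one →CP Op A where
  toFun z := z (1 : ℂ) • (1 : Op A)
  map_add' z w := by simp [add_smul]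
  map_smul' c z := by simp [mul_smul]
  map_cstarMatrix_nonneg' k M hM := by
    obtain ⟨m, S, hS⟩ := exists_of_nonneg hM
    refine nonneg_of_sum _ (fun r i => S r i (1 : ℂ) • (1 : Op A)) fun i j => ?_
    have h : ∀ a b : Op one, (star a * b) (1 : ℂ) = star (a (1 : ℂ)) * b (1 : ℂ) := fun a b => by
      have := ContinuousLinearMap.adjoint_inner_right a (1 : ℂ) (b (1 : ℂ))
      simpa [mul_comm, ContinuousLinearMap.star_eq_adjoint] using this
    rw [CStarMatrix.map_apply, hS]
    refine ContinuousLinearMap.ext fun x => ?_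
    have h' : (∑ r, star (S r i) * S r j : Op one) (1 : ℂ)
        = ∑ r, star (S r i (1 : ℂ)) * S r j (1 : ℂ) := by
      rw [sum_apply]
      exact Finset.sum_congr rfl fun r _ => h _ _
    change ((∑ r, star (S r i) * S r j : Op one) (1 : ℂ) • (1 : Op A)) x = _
    rw [h']
    simp [Finset.sum_smul, smul_smul, mul_comm]

instance : Category Quant where
  Hom A B := Op A.space →CP Op B.space
  id A := cpId A.space
  comp φ ψ := cpComp φ ψ

lemma cp_ext {A B : FHilb} {φ ψ : Op A →CP Op B} (h : φ.toLinearMap = ψ.toLinearMap) : φ = ψ := by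
  cases φ
  cases ψ
  cases h
  rfl

lemma hom_ext {A B : Quant} {φ ψ : A ⟶ B}
    (h : CompletelyPositiveMap.toLinearMap φ = CompletelyPositiveMap.toLinearMap ψ) : φ = ψ :=
  cp_ext h

/-- The canonical functor, which is the identity on objects and sends a linear map `f` to the
completely positive map `ρ ↦ f ρ f†`. -/
def F : FHilb ⥤ Quant where
  obj A := ⟨A⟩
  map f := cpConj f
  map_id A := by
    refine hom_ext (LinearMap.ext fun ρ => ?_)
    change ContinuousLinearMap.id ℂ A ∘L ρ ∘L
      ContinuousLinearMap.adjoint (ContinuousLinearMap.id ℂ A) = ρ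
    rw [← ContinuousLinearMap.one_def, ← ContinuousLinearMap.star_eq_adjoint, star_one]
    rfl
  map_comp f g := by
    refine hom_ext (LinearMap.ext fun ρ => ?_)
    change (g ∘L f) ∘L ρ ∘L ContinuousLinearMap.adjoint (g ∘L f) =
      g ∘L (f ∘L ρ ∘L ContinuousLinearMap.adjoint f) ∘L ContinuousLinearMap.adjoint g
    rw [ContinuousLinearMap.adjoint_comp]
    rfl

/-- A unitary map induces an isomorphism of completely positive maps. -/
def isoOfUnitary {A B : FHilb} (u : A ≃ₗᵢ[ℂ] B) : F.obj A ≅ F.obj B :=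
  F.mapIso
    { hom := (u : A →L[ℂ] B)
      inv := (u.symm : B →L[ℂ] A)
      hom_inv_id := by
        refine ContinuousLinearMap.ext fun x => ?_
        exact u.symm_apply_apply x
      inv_hom_id := by
        refine ContinuousLinearMap.ext fun x => ?_
        exact u.apply_symm_apply x }

instance : MonoidalCategoryStruct Quant where
  tensorObj A B := ⟨tensor A.space B.space⟩
  tensorUnit := ⟨one⟩
  tensorHom φ ψ := cpTensor φ ψ
  whiskerLeft A _ _ φ := cpTensor (cpId A.space) φ
  whiskerRight φ B := cpTensor φ (cpId B.space)
  associator A B C := isoOfUnitary (TensorProduct.assocIsometry ℂ A.space B.space C.space)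
  leftUnitor A := isoOfUnitary (TensorProduct.lidIsometry ℂ A.space)
  rightUnitor A := isoOfUnitary (TensorProduct.ridIsometry ℂ A.space)

lemma isoOfUnitary_hom_apply {A B : FHilb} (u : A ≃ₗᵢ[ℂ] B) (ρ : Op A) (σ : Op B)
    (h : ∀ x, u (ρ x) = σ (u x)) : (cpConj (u : A →L[ℂ] B)).toLinearMap ρ = σ := by
  change (u : A →L[ℂ] B) ∘L ρ ∘L ContinuousLinearMap.adjoint (u : A →L[ℂ] B) = σ
  rw [LinearIsometryEquiv.adjoint_eq_symm]
  refine ContinuousLinearMap.ext fun x => ?_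
  change u (ρ (u.symm x)) = σ x
  rw [h, u.apply_symm_apply]

lemma cpTensor_mapL {A B A' B' : FHilb} (φ : Op A →CP Op A') (ψ : Op B →CP Op B')
    (a : Op A) (b : Op B) : (cpTensor φ ψ).toLinearMap (TensorProduct.mapL a b) =
      TensorProduct.mapL (φ.toLinearMap a) (ψ.toLinearMap b) :=
  opTensorMap_mapL _ _ a b

lemma assoc_mapL (A B C : FHilb) (a : Op A) (b : Op B) (c : Op C) :
    (cpConj (A := tensor (tensor A B) C) (B := tensor A (tensor B C))
      (TensorProduct.assocIsometry ℂ A B C : _ →L[ℂ] _)).toLinearMap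
      (TensorProduct.mapL (TensorProduct.mapL a b) c) =
      TensorProduct.mapL a (TensorProduct.mapL b c) := by
  refine isoOfUnitary_hom_apply (A := tensor (tensor A B) C) (B := tensor A (tensor B C)) _ _ _
    fun x => ?_
  induction x using TensorProduct.induction_on with
  | zero => simp
  | add x y hx hy => simp only [map_add, hx, hy]
  | tmul x z =>
    induction x using TensorProduct.induction_on with
    | zero => simp
    | add x y hx hy => simp only [map_add, TensorProduct.add_tmul, hx, hy]
    | tmul x y => rfl

lemma lid_mapL (A : FHilb) (z : Op one) (a : Op A) :
    (cpConj (A := tensor one A) (TensorProduct.lidIsometry ℂ A : _ →L[ℂ] _)).toLinearMap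
      (TensorProduct.mapL z a) = z (1 : ℂ) • a := by
  refine isoOfUnitary_hom_apply (A := tensor one A) _ _ _ fun x => ?_
  induction x using TensorProduct.induction_on with
  | zero => simp
  | add x y hx hy => simp only [map_add, hx, hy]
  | tmul x y =>
    have : z x = x * z (1 : ℂ) := by simpa using z.map_smul x (1 : ℂ)
    change z x • a y = z (1 : ℂ) • a (x • y)
    rw [this, map_smul, smul_smul, mul_comm]

lemma rid_mapL (A : FHilb) (a : Op A) (z : Op one) :
    (cpConj (A := tensor A one) (TensorProduct.ridIsometry ℂ A : _ →L[ℂ] _)).toLinearMap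
      (TensorProduct.mapL a z) = z (1 : ℂ) • a := by
  refine isoOfUnitary_hom_apply (A := tensor A one) _ _ _ fun x => ?_
  induction x using TensorProduct.induction_on with
  | zero => simp
  | add x y hx hy => simp only [map_add, hx, hy]
  | tmul x y =>
    have : z y = y * z (1 : ℂ) := by simpa using z.map_smul y (1 : ℂ)
    change z y • a x = z (1 : ℂ) • a (y • x)
    rw [this, map_smul, smul_smul, mul_comm]

lemma comm_mapL (A B : FHilb) (a : Op A) (b : Op B) :
    (cpConj (A := tensor A B) (B := tensor B A)
      (TensorProduct.commIsometry ℂ A B : _ →L[ℂ] _)).toLinearMap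
      (TensorProduct.mapL a b) = TensorProduct.mapL b a := by
  refine isoOfUnitary_hom_apply (A := tensor A B) (B := tensor B A) _ _ _ fun x => ?_
  induction x using TensorProduct.induction_on with
  | zero => simp
  | add x y hx hy => simp only [map_add, hx, hy]
  | tmul x y => rfl

lemma assocInv_mapL (A B C : FHilb) (a : Op A) (b : Op B) (c : Op C) :
    (cpConj (A := tensor A (tensor B C)) (B := tensor (tensor A B) C)
      ((TensorProduct.assocIsometry ℂ A B C).symm : _ →L[ℂ] _)).toLinearMap
      (TensorProduct.mapL a (TensorProduct.mapL b c)) =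
      TensorProduct.mapL (TensorProduct.mapL a b) c := by
  refine isoOfUnitary_hom_apply (A := tensor A (tensor B C)) (B := tensor (tensor A B) C) _ _ _
    fun x => ?_
  induction x using TensorProduct.induction_on with
  | zero => simp
  | add x y hx hy => simp only [map_add, hx, hy]
  | tmul z x =>
    induction x using TensorProduct.induction_on with
    | zero => simp
    | add x y hx hy => simp only [map_add, TensorProduct.tmul_add, hx, hy]
    | tmul x y => rfl

lemma tensor_ext {A B X : FHilb} {φ ψ : Op (tensor A B) →CP Op X}
    (h : ∀ a b, φ.toLinearMap (TensorProduct.mapL a b) =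
      ψ.toLinearMap (TensorProduct.mapL a b)) : φ = ψ :=
  cp_ext (opTensor_ext h)

lemma tensor_ext₃ {A B C X : FHilb} {φ ψ : Op (tensor (tensor A B) C) →CP Op X}
    (h : ∀ a b c, φ.toLinearMap (TensorProduct.mapL (TensorProduct.mapL a b) c) =
      ψ.toLinearMap (TensorProduct.mapL (TensorProduct.mapL a b) c)) : φ = ψ := by
  refine tensor_ext fun x c => ?_
  have : φ.toLinearMap ∘ₗ (mapLBilin (H := tensor A B) (K := C)).flip c =
      ψ.toLinearMap ∘ₗ (mapLBilin (H := tensor A B) (K := C)).flip c :=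
    opTensor_ext fun a b => h a b c
  exact LinearMap.congr_fun this x

lemma tensor_ext₃' {A B C X : FHilb} {φ ψ : Op (tensor A (tensor B C)) →CP Op X}
    (h : ∀ a b c, φ.toLinearMap (TensorProduct.mapL a (TensorProduct.mapL b c)) =
      ψ.toLinearMap (TensorProduct.mapL a (TensorProduct.mapL b c))) : φ = ψ := by
  refine tensor_ext fun a x => ?_
  have : φ.toLinearMap ∘ₗ mapLBilin (H := A) (K := tensor B C) a =
      ψ.toLinearMap ∘ₗ mapLBilin (H := A) (K := tensor B C) a :=
    opTensor_ext fun b c => h a b c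
  exact LinearMap.congr_fun this x

lemma tensor_ext₄ {A B C D X : FHilb}
    {φ ψ : Op (tensor (tensor (tensor A B) C) D) →CP Op X}
    (h : ∀ a b c d, φ.toLinearMap
        (TensorProduct.mapL (TensorProduct.mapL (TensorProduct.mapL a b) c) d) =
      ψ.toLinearMap
        (TensorProduct.mapL (TensorProduct.mapL (TensorProduct.mapL a b) c) d)) : φ = ψ := by
  refine tensor_ext₃ fun x c d => ?_
  let T := ((mapLBilin (H := tensor (tensor A B) C) (K := D)).flip d) ∘ₗ
    ((mapLBilin (H := tensor A B) (K := C)).flip c)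
  have : φ.toLinearMap ∘ₗ T = ψ.toLinearMap ∘ₗ T := opTensor_ext fun a b => h a b c d
  exact LinearMap.congr_fun this x

/-- The linear map between operator algebras underlying a morphism. -/
def app {A B : Quant} (f : A ⟶ B) : Op A.space →ₗ[ℂ] Op B.space :=
  CompletelyPositiveMap.toLinearMap f

/-- The tensor product of two operators, as an operator on the tensor product in `Quant`. -/
def tmul {A B : Quant} (a : Op A.space) (b : Op B.space) : Op (A ⊗ B).space :=
  TensorProduct.mapL a b

lemma app_id {A : Quant} (a : Op A.space) : app (𝟙 A) a = a := rfl

lemma app_comp {A B C : Quant} (f : A ⟶ B) (g : B ⟶ C) (a : Op A.space) :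
    app (f ≫ g) a = app g (app f a) := rfl

lemma app_tensorHom {A B A' B' : Quant} (f : A ⟶ A') (g : B ⟶ B') (a : Op A.space)
    (b : Op B.space) : app (f ⊗ₘ g) (tmul a b) = tmul (app f a) (app g b) :=
  cpTensor_mapL (A := A.space) (B := B.space) (A' := A'.space) (B' := B'.space) f g a b

lemma app_whiskerLeft {A B B' : Quant} (g : B ⟶ B') (a : Op A.space)
    (b : Op B.space) : app (A ◁ g) (tmul a b) = tmul a (app g b) :=
  app_tensorHom (𝟙 A) g a b

lemma app_whiskerRight {A B A' : Quant} (f : A ⟶ A') (a : Op A.space)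
    (b : Op B.space) : app (f ▷ B) (tmul a b) = tmul (app f a) b :=
  app_tensorHom f (𝟙 B) a b

lemma app_associator_hom {A B C : Quant} (a : Op A.space) (b : Op B.space) (c : Op C.space) :
    app (α_ A B C).hom (tmul (tmul a b) c) = tmul a (tmul b c) :=
  assoc_mapL _ _ _ a b c

lemma app_associator_inv {A B C : Quant} (a : Op A.space) (b : Op B.space) (c : Op C.space) :
    app (α_ A B C).inv (tmul a (tmul b c)) = tmul (tmul a b) c :=
  assocInv_mapL _ _ _ a b c

/-- The scalar by which an operator on the unit object `ℂ` multiplies. -/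
def scalar (z : Op (𝟙_ Quant).space) : ℂ := (show ℂ →L[ℂ] ℂ from z) 1

lemma app_leftUnitor_hom {A : Quant} (z : Op (𝟙_ Quant).space) (a : Op A.space) :
    app (λ_ A).hom (tmul z a) = scalar z • a :=
  lid_mapL _ z a

lemma app_rightUnitor_hom {A : Quant} (a : Op A.space) (z : Op (𝟙_ Quant).space) :
    app (ρ_ A).hom (tmul a z) = scalar z • a :=
  rid_mapL _ a z

lemma tmul_smul {A B : Quant} (c : ℂ) (a : Op A.space) (b : Op B.space) :
    tmul a (c • b) = c • tmul a b :=
  TensorProduct.mapL_smul_right c a b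

lemma smul_tmul {A B : Quant} (c : ℂ) (a : Op A.space) (b : Op B.space) :
    tmul (c • a) b = c • tmul a b :=
  TensorProduct.mapL_smul_left c a b

lemma ext₂ {A B X : Quant} {f g : A ⊗ B ⟶ X}
    (h : ∀ a b, app f (tmul a b) = app g (tmul a b)) : f = g :=
  tensor_ext h

lemma ext₃ {A B C X : Quant} {f g : (A ⊗ B) ⊗ C ⟶ X}
    (h : ∀ a b c, app f (tmul (tmul a b) c) = app g (tmul (tmul a b) c)) : f = g :=
  tensor_ext₃ h

lemma ext₃' {A B C X : Quant} {f g : A ⊗ (B ⊗ C) ⟶ X}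
    (h : ∀ a b c, app f (tmul a (tmul b c)) = app g (tmul a (tmul b c))) : f = g :=
  tensor_ext₃' h

lemma ext₄ {A B C D X : Quant} {f g : ((A ⊗ B) ⊗ C) ⊗ D ⟶ X}
    (h : ∀ a b c d, app f (tmul (tmul (tmul a b) c) d) = app g (tmul (tmul (tmul a b) c) d)) :
    f = g :=
  tensor_ext₄ h

instance : MonoidalCategory Quant := MonoidalCategory.ofTensorHom
  (id_tensorHom_id := fun A B => ext₂ fun a b => by
    rw [app_tensorHom, app_id, app_id, app_id])
  (id_tensorHom := fun _ _ _ _ => rfl)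
  (tensorHom_id := fun _ _ => rfl)
  (tensorHom_comp_tensorHom := fun f₁ f₂ g₁ g₂ => ext₂ fun a b => by
    simp only [app_comp, app_tensorHom])
  (associator_naturality := fun f₁ f₂ f₃ => ext₃ fun a b c => by
    simp only [app_comp, app_tensorHom, app_associator_hom])
  (leftUnitor_naturality := fun f => ext₂ fun z a => by
    simp only [app_comp, app_tensorHom, app_leftUnitor_hom, app_id, map_smul])
  (rightUnitor_naturality := fun f => ext₂ fun a z => by
    simp only [app_comp, app_tensorHom, app_rightUnitor_hom, app_id, map_smul])
  (pentagon := fun W X Y Z => ext₄ fun a b c d => by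
    simp only [app_comp, app_tensorHom, app_associator_hom, app_id])
  (triangle := fun X Y => ext₃ fun a z b => by
    simp only [app_comp, app_tensorHom, app_associator_hom, app_leftUnitor_hom,
      app_rightUnitor_hom, app_id, tmul_smul, smul_tmul])

/-- The symmetry, induced by the unitary `A ⊗ B ≃ B ⊗ A`. -/
def braidIso (A B : Quant) : A ⊗ B ≅ B ⊗ A :=
  isoOfUnitary (A := tensor A.space B.space) (B := tensor B.space A.space)
    (TensorProduct.commIsometry ℂ A.space B.space)

lemma app_braidIso_hom {A B : Quant} (a : Op A.space) (b : Op B.space) :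
    app (braidIso A B).hom (tmul a b) = tmul b a :=
  comm_mapL _ _ a b

instance : BraidedCategory Quant where
  braiding := braidIso
  braiding_naturality_right X Y Z f := ext₂ fun a b => by
    simp only [app_comp, app_whiskerLeft, app_whiskerRight, app_braidIso_hom]
  braiding_naturality_left f Z := ext₂ fun a b => by
    simp only [app_comp, app_whiskerLeft, app_whiskerRight, app_braidIso_hom]
  hexagon_forward X Y Z := ext₃ fun a b c => by
    simp only [app_comp, app_whiskerLeft, app_whiskerRight, app_associator_hom, app_braidIso_hom]
  hexagon_reverse X Y Z := ext₃' fun a b c => by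
    simp only [app_comp, app_whiskerLeft, app_whiskerRight, app_associator_inv, app_braidIso_hom]

instance : SymmetricCategory Quant where
  symmetry X Y := ext₂ fun a b => by
    change app ((braidIso X Y).hom ≫ (braidIso Y X).hom) _ = _
    rw [app_comp, app_braidIso_hom, app_braidIso_hom, app_id]

/-- The completely mixed state of `A`, whose density matrix is the identity. -/
def mix (A : Quant) : 𝟙_ Quant ⟶ A := cpMix A.space

/-- The class of all completely mixed states, one for each nonzero Hilbert space. -/
def completelyMixedStates : MorphismProperty Quant :=
  MorphismProperty.ofHoms fun A : {A : Quant // Nontrivial A.space} => mix A.1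

end Quant

end

noncomputable section

open FHilb QuantAux

/-! Everything is done with Kraus operators: a completely positive map is `ρ ↦ ∑ᵢ Kᵢ ρ Kᵢ†`
(`exists_eq_kraus`), and two families over one index set give the same map only if a unitary matrix
mixes one into the other (`exists_unitary_of_kraus_eq`). The state `mix C`, tensored with `A`, has
as Kraus operators the inclusions `Iₖ : 1 ⊗ a ↦ eₖ ⊗ a`, which split `C ⊗ A` into orthogonal copies
of `𝟙 ⊗ A`.

Conjugations are pure. Let `g` be `f ⊗ id`. A lifting square says that the families `g Kₜ` and `Lⱼ
Iₖ` give the same map. After padding by zeros, a unitary mixing of the `Kₜ` yields a family `N` for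
the same top map with `g N₍ₖ,ⱼ₎ = Lⱼ Iₖ`. The operators `Hⱼ` that restrict to `N₍ₖ,ⱼ₎` on the `k`-th
copy are Kraus operators of a lift.

Pure maps are conjugations. Let `p` have Kraus operators `Pᵢ`, not all zero, let `C` have one basis
vector for each, and put `V (eᵢ ⊗ a) = Pᵢ a`. Up to unitors, `p` equals `mix C ⊗ A` followed by
conjugation by `V`, so purity yields `h` with `(mix C ⊗ A) ≫ h = id` and `h ≫ p = conj V`. The
identity has only scalar Kraus operators (`eq_smul_id_of_kraus_eq_id`), so `h` restricted to one
summand `eᵢ ⊗ A` is `t • id` with `t ≥ 0`. Hence `t • p` is conjugation by `Pᵢ`; choosing `Pᵢ ≠ 0`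
forces `t > 0`, and `p` is conjugation by `Pᵢ / √t`. -/

/-- Two families of vectors with the same Gram matrix are related by a linear isometry. -/
lemma exists_linearIsometry_of_inner_eq {S E : Type*} [NormedAddCommGroup E]
    [InnerProductSpace ℂ E] [FiniteDimensional ℂ E] (v w : S → E)
    (h : ∀ s t, inner ℂ (v s) (v t) = inner ℂ (w s) (w t)) :
    ∃ U : E →ₗᵢ[ℂ] E, ∀ s, U (v s) = w s := by
  let T := Finsupp.linearCombination ℂ v
  let T' := Finsupp.linearCombination ℂ w
  have hin : ∀ x y, inner ℂ (T x) (T y) = inner ℂ (T' x) (T' y) := fun x y => by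
    simp only [T, T', Finsupp.linearCombination_apply, Finsupp.sum_inner, Finsupp.inner_sum,
      inner_smul_left, inner_smul_right, h]
  have hnorm : ∀ x, ‖T x‖ = ‖T' x‖ := fun x => by
    rw [@norm_eq_sqrt_re_inner ℂ, @norm_eq_sqrt_re_inner ℂ _ _ _ _ (T' x), hin]
  have hker : LinearMap.ker T ≤ LinearMap.ker T' := fun x hx => by
    rw [LinearMap.mem_ker, ← norm_eq_zero, ← hnorm, norm_eq_zero]
    exact hx
  -- Since `T` and `T'` agree in norm, `T'` factors through the range of `T`, and the factor is
  -- isometric.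
  let V : LinearMap.range T →ₗ[ℂ] E :=
    (LinearMap.ker T).liftQ T' hker ∘ₗ T.quotKerEquivRange.symm.toLinearMap
  have hV : ∀ x, V ⟨T x, LinearMap.mem_range_self T x⟩ = T' x := fun x => by
    simp only [V, LinearMap.comp_apply, LinearEquiv.coe_coe]
    rw [LinearMap.quotKerEquivRange_symm_apply_image T x]
    simp
  let W : LinearMap.range T →ₗᵢ[ℂ] E := ⟨V, by
    rintro ⟨_, x, rfl⟩
    rw [hV, ← hnorm]
    rfl⟩
  -- Extension to all of `E` uses finite dimension: the orthogonal complements of the range of `T`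
  -- and of its image have equal dimension.
  refine ⟨W.extend, fun s => ?_⟩
  have h1 : T (Finsupp.single s 1) = v s := by simp [T]
  have h2 : T' (Finsupp.single s 1) = w s := by simp [T']
  rw [← h1, ← h2, ← hV]
  exact W.extend_apply ⟨T (Finsupp.single s 1), LinearMap.mem_range_self T _⟩

namespace Quant

/-! ### Kraus decompositions and their unitary freedom -/

section Kraus

variable {A B C D : Quant} {ι κ : Type} [Fintype ι] [Fintype κ]

/-- The completely positive map `ρ ↦ ∑ᵢ Kᵢ ρ Kᵢ†` with Kraus operators `K`. -/
def kraus (K : ι → (A.space.carrier →L[ℂ] B.space.carrier)) : A ⟶ B where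
  toLinearMap := ∑ i, (cpConj (A := A.space) (B := B.space) (K i)).toLinearMap
  map_cstarMatrix_nonneg' k M hM := by
    obtain ⟨m, S, hS⟩ := exists_of_nonneg hM
    refine nonneg_of_sum_adjoint (A := A.space) (κ := ι × Fin m) _
      (fun r i => S r.2 i ∘L ContinuousLinearMap.adjoint (K r.1)) fun i j => ?_
    rw [Fintype.sum_prod_type, CStarMatrix.map_apply, hS]
    change (∑ i, (cpConj (A := A.space) (B := B.space) (K i)).toLinearMap) _ = _
    rw [LinearMap.sum_apply]
    refine Finset.sum_congr rfl fun r _ => ?_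
    refine ContinuousLinearMap.ext fun x => ?_
    change (K r ∘L (∑ k, star (S k i) * S k j) ∘L ContinuousLinearMap.adjoint (K r)) x = _
    simp [ContinuousLinearMap.adjoint_comp, ContinuousLinearMap.star_eq_adjoint]

lemma app_kraus (K : ι → (A.space.carrier →L[ℂ] B.space.carrier)) (ρ : Op A.space) :
    app (kraus K) ρ = ∑ i, K i ∘L ρ ∘L ContinuousLinearMap.adjoint (K i) := by
  change (∑ i, (cpConj (A := A.space) (B := B.space) (K i)).toLinearMap) _ = _
  rw [LinearMap.sum_apply]
  rfl

lemma app_ext {f g : A ⟶ B} (h : ∀ ρ, app f ρ = app g ρ) : f = g :=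
  hom_ext (LinearMap.ext h)

lemma kraus_comp_kraus (K : ι → (A.space.carrier →L[ℂ] B.space.carrier))
    (L : κ → (B.space.carrier →L[ℂ] C.space.carrier)) :
    kraus K ≫ kraus L = kraus fun s : ι × κ => L s.2 ∘L K s.1 := by
  refine app_ext fun ρ => ?_
  rw [app_comp, app_kraus K, map_sum, app_kraus (fun s : ι × κ => L s.2 ∘L K s.1),
    Fintype.sum_prod_type]
  refine Finset.sum_congr rfl fun i _ => ?_
  rw [app_kraus]
  refine Finset.sum_congr rfl fun j _ => ?_
  rw [ContinuousLinearMap.adjoint_comp]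
  rfl

/-- The right side is an inner product of the coefficient vectors `(⟨w, Kᵢ x⟩)ᵢ` and `(⟨z, Kᵢ y⟩)ᵢ`.
Their Gram matrix thus depends only on the map, not on the chosen Kraus family. -/
lemma inner_app_kraus_rankOne (K : ι → (A.space.carrier →L[ℂ] B.space.carrier))
    (x y : A.space.carrier) (w z : B.space.carrier) :
    inner ℂ z (app (kraus K) (InnerProductSpace.rankOne ℂ y x) w) =
      ∑ i, inner ℂ (K i x) w * inner ℂ z (K i y) := by
  rw [app_kraus, sum_apply, inner_sum]
  refine Finset.sum_congr rfl fun i _ => ?_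
  simp [InnerProductSpace.rankOne_apply, ContinuousLinearMap.adjoint_inner_right,
    inner_smul_right]

/-- The operators `eᵢ eⱼ†` are matrix units and span the operator algebra. -/
lemma hom_ext_rankOne {f g : A ⟶ B}
    (h : ∀ i j, app f (InnerProductSpace.rankOne ℂ (stdOrthonormalBasis ℂ A.space.carrier i)
        (stdOrthonormalBasis ℂ A.space.carrier j)) =
      app g (InnerProductSpace.rankOne ℂ (stdOrthonormalBasis ℂ A.space.carrier i)
        (stdOrthonormalBasis ℂ A.space.carrier j))) : f = g := by
  refine app_ext fun ρ => ?_
  let e := stdOrthonormalBasis ℂ A.space.carrier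
  have hρ : ρ = ∑ i, ∑ j, inner ℂ (e i) (ρ (e j)) • InnerProductSpace.rankOne ℂ (e i) (e j) := by
    refine ContinuousLinearMap.ext fun x => ?_
    conv_lhs => rw [← e.sum_repr' x, map_sum]
    simp only [sum_apply, smul_apply, InnerProductSpace.rankOne_apply]
    rw [Finset.sum_comm]
    refine Finset.sum_congr rfl fun j _ => ?_
    conv_lhs => rw [map_smul, ← e.sum_repr' (ρ (e j)), Finset.smul_sum]
    exact Finset.sum_congr rfl fun i _ => smul_comm _ _ _
  rw [hρ]
  simp only [map_sum, map_smul]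
  exact Finset.sum_congr rfl fun i _ => Finset.sum_congr rfl fun j _ => congrArg _ (h i j)

/-- Every completely positive map has a Kraus decomposition. -/
theorem exists_eq_kraus (φ : A ⟶ B) :
    ∃ (n : ℕ) (K : Fin n → (A.space.carrier →L[ℂ] B.space.carrier)), φ = kraus K := by
  let e := stdOrthonormalBasis ℂ A.space.carrier
  let f := stdOrthonormalBasis ℂ B.space.carrier
  -- The zero space is separate because the main case needs a unit vector `u`.
  rcases subsingleton_or_nontrivial A.space.carrier with hA | hA
  · refine ⟨0, fun i => i.elim0, app_ext fun ρ => ?_⟩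
    have : ρ = 0 := ContinuousLinearMap.ext fun x => Subsingleton.elim _ _
    rw [this, map_zero, map_zero]
  obtain ⟨u, hu⟩ := exists_norm_eq A.space.carrier (zero_le_one' ℝ)
  -- This is positivity of the Choi matrix: `(u eᵢ†)† (u eⱼ†) = eᵢ eⱼ†`, so the values of `φ` on
  -- matrix units take the form `∑ᵣ cᵣᵢ† cᵣⱼ`.
  obtain ⟨p, c, hc⟩ := exists_of_completelyPositive (X := Op A.space) (Y := Op B.space) φ
    (fun i => InnerProductSpace.rankOne ℂ u (e i))
  suffices ∃ K : Fin p × Fin (Module.finrank ℂ B.space.carrier) →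
      (A.space.carrier →L[ℂ] B.space.carrier), φ = kraus K by
    obtain ⟨K, rfl⟩ := this
    refine ⟨_, K ∘ (Fintype.equivFin _).symm, app_ext fun ρ => ?_⟩
    rw [app_kraus, app_kraus, ← Equiv.sum_comp (Fintype.equivFin _).symm]
    rfl
  -- Inserting `∑ₗ fₗ fₗ† = 1` between `cᵣᵢ†` and `cᵣⱼ` suggests the Kraus operators `eᵢ ↦ cᵣᵢ† fₗ`.
  obtain ⟨K, hK⟩ : ∃ K : Fin p × Fin (Module.finrank ℂ B.space.carrier) →
      (A.space.carrier →L[ℂ] B.space.carrier),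
      ∀ s i, K s (e i) = ContinuousLinearMap.adjoint (c s.1 i) (f s.2) := by
    refine ⟨fun s => ∑ i, InnerProductSpace.rankOne ℂ
      (ContinuousLinearMap.adjoint (c s.1 i) (f s.2)) (e i), fun s i => ?_⟩
    rw [sum_apply, Finset.sum_eq_single i]
    · simp [InnerProductSpace.rankOne_apply, inner_self_eq_norm_sq_to_K]
    · intro j _ hj
      simp [InnerProductSpace.rankOne_apply, e.orthonormal.inner_eq_zero hj]
    · simp
  refine ⟨K, hom_ext_rankOne fun i j => ?_⟩
  have h1 : app φ (InnerProductSpace.rankOne ℂ (e i) (e j)) = ∑ r, star (c r i) * c r j := by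
    rw [← hc]
    change app φ _ = app φ _
    congr 1
    refine ContinuousLinearMap.ext fun x => ?_
    simp [ContinuousLinearMap.star_eq_adjoint, InnerProductSpace.rankOne_apply, hu,
      inner_self_eq_norm_sq_to_K]
  refine h1.trans (ContinuousLinearMap.ext fun w => ext_inner_left ℂ fun z => ?_)
  rw [inner_app_kraus_rankOne, Fintype.sum_prod_type, sum_apply, inner_sum]
  refine Finset.sum_congr rfl fun r _ => ?_
  have hr := f.sum_inner_mul_inner (c r i z) (c r j w)
  rw [ContinuousLinearMap.star_eq_adjoint, mul_apply_eq_comp,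
    ContinuousLinearMap.adjoint_inner_right, ← hr]
  refine Finset.sum_congr rfl fun l _ => ?_
  have h2 : inner ℂ (K (r, l) (e j)) w = inner ℂ (f l) (c r j w) := by
    rw [hK, ContinuousLinearMap.adjoint_inner_left]
  have h3 : inner ℂ z (K (r, l) (e i)) = inner ℂ (c r i z) (f l) := by
    rw [hK, ContinuousLinearMap.adjoint_inner_right]
  exact (mul_comm _ _).trans (congrArg₂ (· * ·) h2.symm h3.symm)

/-- Kraus families of the same map over the same index type are related by a unitary matrix. -/
theorem exists_unitary_of_kraus_eq [DecidableEq ι]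
    {K L : ι → (A.space.carrier →L[ℂ] B.space.carrier)}
    (h : kraus K = kraus L) :
    ∃ u : ι → ι → ℂ, (∀ j k, ∑ i, u i j * star (u i k) = if j = k then 1 else 0) ∧
      ∀ i, L i = ∑ j, u i j • K j := by
  -- `v K (x, y)` collects the matrix coefficients `⟨y, Kᵢ x⟩` over `i`; a linear relation between
  -- the `v K` and the `v L` is one between the operators.
  let v (K : ι → (A.space.carrier →L[ℂ] B.space.carrier)) (s : A.space.carrier × B.space.carrier) :
      EuclideanSpace ℂ ι := WithLp.toLp 2 fun i => inner ℂ s.2 (K i s.1)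
  have hv : ∀ K s t, inner ℂ (v K s) (v K t) =
      inner ℂ t.2 (app (kraus K) (InnerProductSpace.rankOne ℂ t.1 s.1) s.2) := fun K s t => by
    rw [inner_app_kraus_rankOne, PiLp.inner_apply]
    simp [v, mul_comm]
  obtain ⟨U, hU⟩ := exists_linearIsometry_of_inner_eq (v K) (v L) fun s t => by rw [hv, hv, h]
  let b := EuclideanSpace.basisFun ι ℂ
  refine ⟨fun i j => U (b j) i, fun j k => ?_, fun i => ?_⟩
  · have h1 : inner ℂ (U (b k)) (U (b j)) = if j = k then 1 else 0 := by
      rw [U.inner_map_map, orthonormal_iff_ite.mp b.orthonormal]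
      simp [eq_comm]
    rw [← h1, PiLp.inner_apply]
    simp
  · refine ContinuousLinearMap.ext fun x => ext_inner_left ℂ fun y => ?_
    have h1 : inner ℂ y (L i x) = U (v K (x, y)) i := by rw [hU]
    have h2 : v K (x, y) = ∑ j, inner ℂ y (K j x) • b j := by
      rw [← b.sum_repr (v K (x, y))]
      rfl
    rw [h1, h2, map_sum, sum_apply, inner_sum]
    simp [inner_smul_right, mul_comm]

/-- Mixing a Kraus family by a unitary matrix does not change the map. -/
lemma kraus_sum_smul [DecidableEq ι]
    (K : ι → (A.space.carrier →L[ℂ] B.space.carrier)) (u : ι → ι → ℂ)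
    (hu : ∀ j k, ∑ i, u i j * star (u i k) = if j = k then 1 else 0) :
    kraus (fun i => ∑ j, u i j • K j) = kraus K := by
  refine app_ext fun ρ => ?_
  rw [app_kraus, app_kraus]
  have h1 : ∀ i, (∑ j, u i j • K j) ∘L ρ ∘L ContinuousLinearMap.adjoint (∑ j, u i j • K j) =
      ∑ j, ∑ k, (u i j * star (u i k)) • (K j ∘L ρ ∘L ContinuousLinearMap.adjoint (K k)) := by
    intro i
    refine ContinuousLinearMap.ext fun x => ?_
    simp only [ContinuousLinearMap.comp_apply, map_sum, sum_apply, smul_apply,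
      map_smulₛₗ, mul_smul, Finset.smul_sum]
    rw [Finset.sum_comm]
    refine Finset.sum_congr rfl fun j _ => Finset.sum_congr rfl fun k _ => ?_
    exact smul_comm _ _ _
  simp only [h1]
  rw [Finset.sum_comm]
  refine Finset.sum_congr rfl fun j _ => ?_
  rw [Finset.sum_comm]
  simp only [← Finset.sum_smul, hu]
  simp

/-- Extending a Kraus family by zero does not change the map. -/
lemma kraus_extend (K : ι → (A.space.carrier →L[ℂ] B.space.carrier)) {e : ι → κ}
    (he : Function.Injective e) : kraus (Function.extend e K 0) = kraus K := by
  refine app_ext fun ρ => ?_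
  rw [app_kraus, app_kraus]
  refine (Fintype.sum_of_injective e he _ _ (fun k hk => ?_) fun i => ?_).symm
  · rw [Function.extend_apply' _ _ _ hk]
    simp
  · rw [he.extend_apply]

/-- The Kraus operators of the identity are scalars. -/
lemma eq_smul_id_of_kraus_eq_id {K : ι → (A.space.carrier →L[ℂ] A.space.carrier)}
    (h : kraus K = 𝟙 A) (i : ι) : ∃ c : ℂ, K i = c • .id ℂ A.space.carrier := by
  classical
  -- The one-element family `id`, placed at index `i` and padded by zeros, represents the identity
  -- over the same index set as `K`.
  have h1 : kraus (Function.extend (fun _ : Unit => i) (fun _ => .id ℂ A.space.carrier) 0) =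
      kraus K := by
    rw [kraus_extend _ fun _ _ _ => rfl, h]
    refine app_ext fun ρ => ?_
    rw [app_kraus, ContinuousLinearMap.adjoint_id, app_id]
    simp
  obtain ⟨u, -, hu⟩ := exists_unitary_of_kraus_eq h1
  refine ⟨u i i, ?_⟩
  rw [hu i, Finset.sum_eq_single i]
  · congr 1
    exact (show Function.Injective fun _ : Unit => i from fun _ _ _ => rfl).extend_apply _ _ ()
  · intro j _ hj
    rw [Function.extend_apply' _ _ _ fun ⟨_, h⟩ => hj h.symm]
    simp
  · simp

/-! ### Conjugations as one-element Kraus families -/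

/-- The morphism `ρ ↦ f ρ f†` of conjugation by a linear map `f`. -/
abbrev conj (f : A.space.carrier →L[ℂ] B.space.carrier) : A ⟶ B := kraus fun _ : Unit => f

lemma app_conj (f : A.space.carrier →L[ℂ] B.space.carrier) (ρ : Op A.space) :
    app (conj f) ρ = f ∘L ρ ∘L ContinuousLinearMap.adjoint f := by
  rw [app_kraus]
  exact Fintype.sum_unique _

lemma conj_eq_F_map (f : A.space.carrier →L[ℂ] B.space.carrier) :
    conj f = (F.map (X := A.space) (Y := B.space) f : A ⟶ B) :=
  app_ext (app_conj f)

/-- Together with `conj_comp_kraus`, this keeps the index type `ι`, where `kraus_comp_kraus` would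
introduce a factor `Unit`. -/
lemma kraus_comp_conj (K : ι → (A.space.carrier →L[ℂ] B.space.carrier))
    (f : B.space.carrier →L[ℂ] C.space.carrier) :
    kraus K ≫ conj f = kraus fun i => f ∘L K i := by
  refine app_ext fun ρ => ?_
  rw [app_comp, app_conj, app_kraus, app_kraus]
  refine ContinuousLinearMap.ext fun x => ?_
  simp [ContinuousLinearMap.adjoint_comp]

lemma conj_comp_kraus (f : A.space.carrier →L[ℂ] B.space.carrier)
    (K : ι → (B.space.carrier →L[ℂ] C.space.carrier)) :
    conj f ≫ kraus K = kraus fun i => K i ∘L f := by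
  refine app_ext fun ρ => ?_
  rw [app_comp, app_conj, app_kraus, app_kraus]
  simp only [ContinuousLinearMap.adjoint_comp]
  rfl

/-! ### Tensor products of Kraus operators -/

/-- The tensor product of linear maps, between underlying spaces of objects of `Quant`. -/
def tensorMap (f : A.space.carrier →L[ℂ] C.space.carrier)
    (g : B.space.carrier →L[ℂ] D.space.carrier) :
    (A ⊗ B).space.carrier →L[ℂ] (C ⊗ D).space.carrier :=
  TensorProduct.mapL f g

lemma tensorMap_comp {A' B' : Quant} (f : A.space.carrier →L[ℂ] C.space.carrier)
    (g : B.space.carrier →L[ℂ] D.space.carrier) (f' : A'.space.carrier →L[ℂ] A.space.carrier)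
    (g' : B'.space.carrier →L[ℂ] B.space.carrier) :
    tensorMap f g ∘L tensorMap f' g' = tensorMap (f ∘L f') (g ∘L g') :=
  (TensorProduct.mapL_comp f f' g g').symm

lemma adjoint_tensorMap (f : A.space.carrier →L[ℂ] C.space.carrier)
    (g : B.space.carrier →L[ℂ] D.space.carrier) :
    ContinuousLinearMap.adjoint (tensorMap f g) =
      tensorMap (ContinuousLinearMap.adjoint f) (ContinuousLinearMap.adjoint g) :=
  TensorProduct.adjoint_mapL f g

lemma tensorMap_id : tensorMap (.id ℂ A.space.carrier) (.id ℂ B.space.carrier) =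
    .id ℂ (A ⊗ B).space.carrier :=
  TensorProduct.mapL_id_id

lemma tensorMap_smul_left (c : ℂ) (f : A.space.carrier →L[ℂ] C.space.carrier)
    (g : B.space.carrier →L[ℂ] D.space.carrier) :
    tensorMap (c • f) g = c • tensorMap f g :=
  TensorProduct.mapL_smul_left c f g

lemma tensorMap_sum_left (f : ι → (A.space.carrier →L[ℂ] C.space.carrier))
    (g : B.space.carrier →L[ℂ] D.space.carrier) :
    tensorMap (∑ i, f i) g = ∑ i, tensorMap (f i) g :=
  let T : (A.space.carrier →L[ℂ] C.space.carrier) →+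
      ((A ⊗ B).space.carrier →L[ℂ] (C ⊗ D).space.carrier) :=
    { toFun := fun f => tensorMap f g
      map_zero' := TensorProduct.mapL_zero_left g
      map_add' := fun f f' => TensorProduct.mapL_add_left f f' g }
  map_sum T f _

lemma kraus_whiskerRight (K : ι → (A.space.carrier →L[ℂ] B.space.carrier)) (C : Quant) :
    kraus K ▷ C = kraus fun i => tensorMap (K i) (.id ℂ C.space.carrier) := by
  refine ext₂ fun a c => ?_
  rw [app_whiskerRight, app_kraus, app_kraus]
  refine (tensorMap_sum_left (fun i => K i ∘L a ∘L ContinuousLinearMap.adjoint (K i)) c).trans ?_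
  refine Finset.sum_congr rfl fun i _ => ?_
  rw [adjoint_tensorMap]
  change _ = _ ∘L tensorMap a c ∘L _
  rw [tensorMap_comp, tensorMap_comp, ContinuousLinearMap.adjoint_id]
  rfl

/-! ### Kraus operators of the completely mixed states -/

/-- The linear map `ℂ → C` that sends `1` to the `k`-th vector of an orthonormal basis. -/
def ket (C : Quant) (k : Fin (Module.finrank ℂ C.space.carrier)) :
    (𝟙_ Quant).space.carrier →L[ℂ] C.space.carrier :=
  (ContinuousLinearMap.toSpanSingleton ℂ (stdOrthonormalBasis ℂ C.space.carrier k) :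
    ℂ →L[ℂ] C.space.carrier)

lemma adjoint_ket (C : Quant) (k : Fin (Module.finrank ℂ C.space.carrier)) :
    ContinuousLinearMap.adjoint (ket C k) =
      (innerSL ℂ (stdOrthonormalBasis ℂ C.space.carrier k) : C.space.carrier →L[ℂ] ℂ) :=
  ContinuousLinearMap.adjoint_toSpanSingleton _

lemma adjoint_ket_comp (C : Quant) (k l : Fin (Module.finrank ℂ C.space.carrier)) :
    ContinuousLinearMap.adjoint (ket C k) ∘L ket C l =
      (if k = l then 1 else 0 : ℂ) • .id ℂ (𝟙_ Quant).space.carrier := by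
  rw [adjoint_ket, ← orthonormal_iff_ite.mp (stdOrthonormalBasis ℂ C.space.carrier).orthonormal]
  refine ContinuousLinearMap.ext fun (z : ℂ) => ?_
  exact (inner_smul_right (𝕜 := ℂ) _ _ z).trans (mul_comm z _)

lemma sum_ket_comp_adjoint (C : Quant) :
    ∑ k, ket C k ∘L ContinuousLinearMap.adjoint (ket C k) = .id ℂ C.space.carrier := by
  simp only [adjoint_ket]
  refine ContinuousLinearMap.ext fun x => ?_
  rw [sum_apply]
  exact (stdOrthonormalBasis ℂ C.space.carrier).sum_repr' x

/-- This is the resolution of the identity `∑ₖ eₖ eₖ† = 1`, scaled by `z`. -/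
lemma mix_eq_kraus (C : Quant) : mix C = kraus (ket C) := by
  refine app_ext fun z => ?_
  have hz : z = scalar z • .id ℂ (𝟙_ Quant).space.carrier := by
    refine ContinuousLinearMap.ext fun (x : ℂ) => ?_
    have := (show ℂ →L[ℂ] ℂ from z).map_smul x (1 : ℂ)
    exact ((congrArg (show ℂ →L[ℂ] ℂ from z) (mul_one x).symm).trans this).trans (mul_comm _ _)
  rw [app_kraus]
  change scalar z • (1 : Op C.space) = _
  rw [ContinuousLinearMap.one_def, ← sum_ket_comp_adjoint, Finset.smul_sum]
  refine Finset.sum_congr rfl fun k _ => ?_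
  conv_rhs => rw [hz]
  refine ContinuousLinearMap.ext fun x => ?_
  simp

/-- The linear map `𝟙 ⊗ A → C ⊗ A` that sends `1 ⊗ a` to `eₖ ⊗ a`. -/
def basisIncl (C A : Quant) (k : Fin (Module.finrank ℂ C.space.carrier)) :
    (𝟙_ Quant ⊗ A).space.carrier →L[ℂ] (C ⊗ A).space.carrier :=
  tensorMap (ket C k) (.id ℂ A.space.carrier)

lemma mix_whiskerRight (C A : Quant) : mix C ▷ A = kraus (basisIncl C A) := by
  rw [mix_eq_kraus, kraus_whiskerRight]
  rfl

/-- With `sum_basisIncl_comp_adjoint` this makes `C ⊗ A` the orthogonal sum of copies of `𝟙 ⊗ A`: a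
linear map out of it can be prescribed freely on each copy. -/
lemma adjoint_basisIncl_comp (C A : Quant) (k l : Fin (Module.finrank ℂ C.space.carrier)) :
    ContinuousLinearMap.adjoint (basisIncl C A k) ∘L basisIncl C A l =
      (if k = l then 1 else 0 : ℂ) • .id ℂ (𝟙_ Quant ⊗ A).space.carrier := by
  rw [basisIncl, basisIncl, adjoint_tensorMap, tensorMap_comp, adjoint_ket_comp,
    tensorMap_smul_left, ← tensorMap_id, ContinuousLinearMap.adjoint_id]
  rfl

lemma sum_basisIncl_comp_adjoint (C A : Quant) :
    ∑ k, basisIncl C A k ∘L ContinuousLinearMap.adjoint (basisIncl C A k) =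
      .id ℂ (C ⊗ A).space.carrier := by
  simp only [basisIncl, adjoint_tensorMap, tensorMap_comp]
  rw [← tensorMap_sum_left, sum_ket_comp_adjoint, ContinuousLinearMap.adjoint_id]
  exact tensorMap_id

end Kraus

/-! ### Pure morphisms are exactly the conjugations -/

section Pure

variable {A B : Quant}

/-- Conjugation by a linear map is pure. -/
theorem pureMorphisms_conj (f : A.space.carrier →L[ℂ] B.space.carrier) :
    pureMorphisms completelyMixedStates (conj f : A ⟶ B) := by
  rintro _ _ _ ⟨⟨C, hC⟩⟩ Z W
  refine ⟨fun {a b} sq => ?_⟩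
  obtain ⟨m, L, rfl⟩ := exists_eq_kraus b
  obtain ⟨r, K, rfl⟩ := exists_eq_kraus a
  let g := tensorMap f (.id ℂ W.space.carrier)
  have hg : (conj f : A ⟶ B) ▷ W = conj g := kraus_whiskerRight _ W
  let I := basisIncl C Z
  let k₀ : Fin (Module.finrank ℂ C.space.carrier) := ⟨0, Module.finrank_pos⟩
  -- The common index set must be a product with the basis of `C`, so that `L' ∘ I` fills it, and
  -- must have room for `K`. Hence the second factor `Fin m ⊕ Fin r`, with `K` put over the single
  -- basis index `k₀`, which exists because `C` is nonzero.
  let L' : Fin m ⊕ Fin r → _ := Function.extend Sum.inl L 0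
  let K' : Fin (Module.finrank ℂ C.space.carrier) × (Fin m ⊕ Fin r) → _ :=
    Function.extend (fun i => (k₀, Sum.inr i)) K 0
  have hL : kraus L' = kraus L := kraus_extend L Sum.inl_injective
  have hK : kraus K' = kraus K := kraus_extend K fun i j h => by simpa using h
  have hw : kraus (fun s => g ∘L K' s) =
      kraus fun s : Fin (Module.finrank ℂ C.space.carrier) × (Fin m ⊕ Fin r) =>
        L' s.2 ∘L I s.1 := by
    rw [← kraus_comp_conj, ← kraus_comp_kraus, hL, hK, ← hg, ← mix_whiskerRight]
    exact sq.w
  obtain ⟨u, hu, hu'⟩ := exists_unitary_of_kraus_eq hw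
  -- The unitary found after composing with `g` is applied before it, which leaves the top map of
  -- the square unchanged.
  let N s := ∑ t, u s t • K' t
  have hN : kraus N = kraus K := (kraus_sum_smul K' u hu).trans hK
  have hgN : ∀ s, g ∘L N s = L' s.2 ∘L I s.1 := fun s => by
    rw [hu' s]
    refine ContinuousLinearMap.ext fun x => ?_
    simp [N, sum_apply, map_sum]
  -- `H j` is glued from the `N (k, j)` over the orthogonal copies. Orthogonality of the copies
  -- gives the upper triangle, their completeness the lower one.
  let H j := ∑ k, N (k, j) ∘L ContinuousLinearMap.adjoint (I k)
  have hHI : ∀ k j, H j ∘L I k = N (k, j) := fun k j => by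
    simp only [H, ContinuousLinearMap.finsetSum_comp, ContinuousLinearMap.comp_assoc]
    simp only [I, adjoint_basisIncl_comp]
    rw [Finset.sum_eq_single k]
    · simp
    · intro l _ hl
      simp [hl]
    · simp
  have hgH : ∀ j, g ∘L H j = L' j := fun j => by
    simp only [H, ContinuousLinearMap.comp_finsetSum, ← ContinuousLinearMap.comp_assoc, hgN]
    simp only [ContinuousLinearMap.comp_assoc, I]
    rw [← ContinuousLinearMap.comp_finsetSum, sum_basisIncl_comp_adjoint,
      ContinuousLinearMap.comp_id]
  refine ⟨⟨⟨kraus H, ?_, ?_⟩⟩⟩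
  · rw [mix_whiskerRight, kraus_comp_kraus, ← hN]
    exact congrArg kraus (funext fun s => hHI s.1 s.2)
  · rw [hg, kraus_comp_conj, ← hL]
    exact congrArg kraus (funext hgH)

/-- At `ρ = 1` the value is `f f†`, which vanishes only if `f` does. -/
lemma conj_ne_zero {f : A.space.carrier →L[ℂ] B.space.carrier} (hf : f ≠ 0) :
    ∃ ρ, app (conj f) ρ ≠ 0 := by
  by_contra! h
  refine hf ?_
  have h1 : ContinuousLinearMap.adjoint f = 0 := by
    refine ContinuousLinearMap.ext fun x => ?_
    have h2 : f (ContinuousLinearMap.adjoint f x) = 0 := by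
      have := congrArg (fun T : Op B.space => T x) ((app_conj f _).symm.trans (h 1))
      exact this
    rw [zero_apply, ← inner_self_eq_zero (𝕜 := ℂ), ContinuousLinearMap.adjoint_inner_left, h2,
      inner_zero_right]
  rw [← ContinuousLinearMap.adjoint_adjoint f, h1, map_zero]

/-- A nonnegative multiple of `p` that is conjugation by a nonzero map exhibits `p` as a
conjugation. -/
lemma exists_conj_eq_of_scalar_comp {ι : Type} [Fintype ι] (p : A ⟶ B) (c : ι → ℂ)
    {f : A.space.carrier →L[ℂ] B.space.carrier} (hf : f ≠ 0)
    (h : kraus (fun i => c i • .id ℂ A.space.carrier) ≫ p = conj f) :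
    ∃ f' : A.space.carrier →L[ℂ] B.space.carrier, conj f' = p := by
  -- The scalar family acts as multiplication by `t`, so `t • p` is conjugation by `f`, and `f / √t`
  -- will serve.
  let t : ℝ := ∑ i, ‖c i‖ ^ 2
  have ht : ∀ ρ, (t : ℂ) • app p ρ = app (conj f) ρ := fun ρ => by
    rw [← h, app_comp, ← map_smul, app_kraus]
    congr 1
    refine ContinuousLinearMap.ext fun x => ?_
    simp [t, Finset.sum_smul, smul_smul, map_smulₛₗ, ContinuousLinearMap.adjoint_id,
      Complex.conj_mul', sum_apply]
  have ht0 : t ≠ 0 := fun h0 => by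
    obtain ⟨ρ, hρ⟩ := conj_ne_zero hf
    refine hρ ?_
    rw [← ht, h0]
    simp
  have ht1 : 0 < t := lt_of_le_of_ne (Finset.sum_nonneg fun i _ => by positivity) ht0.symm
  refine ⟨((Real.sqrt t)⁻¹ : ℂ) • f, app_ext fun ρ => ?_⟩
  have hs : ((Real.sqrt t : ℂ)⁻¹ * (Real.sqrt t : ℂ)⁻¹) * t = 1 := by
    rw [← mul_inv, ← Complex.ofReal_mul, Real.mul_self_sqrt ht1.le, inv_mul_cancel₀]
    exact_mod_cast ht0
  rw [← one_smul ℂ (app p ρ), ← hs, mul_smul, ht, app_conj, app_conj]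
  refine ContinuousLinearMap.ext fun x => ?_
  simp [smul_smul, map_smulₛₗ, Complex.conj_ofReal]

/-- A pure completely positive map is conjugation by a linear map. -/
theorem exists_conj_eq_of_pure (p : A ⟶ B)
    (hp : pureMorphisms completelyMixedStates p) :
    ∃ f : A.space.carrier →L[ℂ] B.space.carrier, conj f = p := by
  obtain ⟨r, P, hP⟩ := exists_eq_kraus p
  by_cases hP0 : ∀ i, P i = 0
  · refine ⟨0, app_ext fun ρ => ?_⟩
    rw [hP, app_conj, app_kraus]
    simp [hP0]
  push Not at hP0
  obtain ⟨i₀, hi₀⟩ := hP0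
  -- Substituting `r` lets the Kraus operators of `p` be indexed by the basis of `C`.
  obtain ⟨C, rfl⟩ : ∃ C : Quant, Module.finrank ℂ C.space.carrier = r :=
    ⟨⟨⟨EuclideanSpace ℂ (Fin r)⟩⟩, finrank_euclideanSpace_fin⟩
  have hC : Nontrivial C.space.carrier := Module.nontrivial_of_finrank_pos (R := ℂ) i₀.pos
  let l : (𝟙_ Quant ⊗ A).space.carrier →L[ℂ] A.space.carrier :=
    (TensorProduct.lidIsometry ℂ A.space : _ →L[ℂ] _)
  have hl : (λ_ A).hom = conj l := (conj_eq_F_map l).symm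
  let l' : A.space.carrier →L[ℂ] (𝟙_ Quant ⊗ A).space.carrier :=
    ((TensorProduct.lidIsometry ℂ A.space).symm : _ →L[ℂ] _)
  have hl' : (λ_ A).inv = conj l' := (conj_eq_F_map l').symm
  let s : B.space.carrier →L[ℂ] (B ⊗ 𝟙_ Quant).space.carrier :=
    ((TensorProduct.ridIsometry ℂ B.space).symm : _ →L[ℂ] _)
  have hs : (ρ_ B).inv = conj s := (conj_eq_F_map s).symm
  let I := basisIncl C A
  -- Up to unitors, `V` sends `eᵢ ⊗ a` to `P i a`: it gathers all Kraus operators of `p` into one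
  -- linear map.
  let V := ∑ i, (s ∘L P i ∘L l) ∘L ContinuousLinearMap.adjoint (I i)
  have hVI : ∀ i, V ∘L I i = s ∘L P i ∘L l := fun i => by
    simp only [V, ContinuousLinearMap.finsetSum_comp]
    simp only [I, ContinuousLinearMap.comp_assoc, adjoint_basisIncl_comp]
    rw [Finset.sum_eq_single i]
    · simp
    · intro j _ hj
      simp [hj]
    · simp
  have hsq : CommSq ((λ_ A).hom ≫ (ρ_ A).inv) (mix C ▷ A) (p ▷ 𝟙_ Quant) (conj V) := ⟨by
    rw [Category.assoc, ← rightUnitor_inv_naturality, mix_whiskerRight, kraus_comp_conj, hP, hl,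
      hs, kraus_comp_conj, conj_comp_kraus]
    exact congrArg kraus (funext fun i => (hVI i).symm)⟩
  have hlift := (hp (mix C) (MorphismProperty.ofHoms_iff _ _ |>.2 ⟨⟨C, hC⟩, rfl⟩) A
    (𝟙_ Quant)).sq_hasLift hsq
  obtain ⟨h, hh1, hh2⟩ := hlift.exists_lift.some
  obtain ⟨m, H, hH⟩ := exists_eq_kraus (h ≫ (ρ_ A).hom)
  -- The upper triangle says that the lift, precomposed with the mixed state, is the identity of `A`
  -- up to unitors.
  have hid : kraus (fun t : Fin (Module.finrank ℂ C.space.carrier) × Fin m =>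
      (H t.2 ∘L I t.1) ∘L l') = 𝟙 A := by
    rw [← conj_comp_kraus, ← kraus_comp_kraus, ← hH, ← mix_whiskerRight, reassoc_of% hh1, ← hl']
    simp
  choose c hc using eq_smul_id_of_kraus_eq_id hid
  -- Restricted to the summand `e_{i₀} ⊗ A`, the lift is the scalar family `c (i₀, ·)`, while the
  -- lower triangle turns the lift followed by `p` into conjugation by `P i₀`.
  refine exists_conj_eq_of_scalar_comp p (fun j => c (i₀, j)) hi₀ ?_
  have h1 : kraus (fun j => c (i₀, j) • .id ℂ A.space.carrier) =
      (λ_ A).inv ≫ conj (I i₀) ≫ h ≫ (ρ_ A).hom := by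
    rw [hH, conj_comp_kraus, hl', conj_comp_kraus]
    exact congrArg kraus (funext fun j => (hc (i₀, j)).symm)
  have h2 : conj (I i₀) ≫ conj V = (λ_ A).hom ≫ conj (P i₀) ≫ (ρ_ B).inv := by
    rw [kraus_comp_conj, hVI, hl, hs, kraus_comp_conj, conj_comp_kraus]
    rfl
  rw [h1]
  simp only [Category.assoc]
  rw [← rightUnitor_naturality, reassoc_of% hh2, reassoc_of% h2]
  simp

end Pure

end Quant

end

theorem mainTheorem2 {A B : Quant} (p : A ⟶ B) :
    pureMorphisms Quant.completelyMixedStates p ↔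
      ∃ f : A.space ⟶ B.space, Quant.F.map f = p := by
  constructor
  · intro hp
    obtain ⟨f, hf⟩ := Quant.exists_conj_eq_of_pure p hp
    exact ⟨f, (Quant.conj_eq_F_map f).symm.trans hf⟩
  · rintro ⟨f, rfl⟩
    have h := Quant.pureMorphisms_conj f
    rwa [Quant.conj_eq_F_map] at h
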